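/- For an open set $\Omega\subseteq\mathbb{C}$ let $\mathcal{A}(\Omega)$ be the set of complex analytic functions on $\Omega$, with pointwise addition, the bracket $[f,g]=fg'-f'g$, and the compact-open topology (uniform convergence on compact subsets of $\Omega$). A \emph{Polish Lie ring} is a Lie ring carrying a Polish (separable, completely metrizable) topology for which addition, negation and the bracket are continuous. \textbf{Theorem.} Let $n\ge 0$, let $\lambda_1,\dots,\lambda_n\in\mathbb{C}$, and let $\Omega=\mathbb{C}\setminus\{\lambda_1,\dots,\lambda_n\}$. Then $\mathcal{A}(\Omega)$ is an algebraically determined Polish Lie ring: it is a Polish Lie ring, and whenever $\mathcal{L}$ is a Polish Lie ring and $\varphi:\mathcal{L}\to\mathcal{A}(\Omega)$ is an (abstract) isomorphism of Lie rings, $\varphi$ is a homeomorphism. -/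

import Mathlib

open TopologicalSpace

universe u v

/-- A Polish Lie ring: a Lie ring with a Polish (separable, completely metrizable) topology for
which addition, negation and the bracket are continuous. -/
structure IsPolishLieRing (L : Type*) [LieRing L] [TopologicalSpace L] : Prop where
  polish : PolishSpace L
  topologicalAddGroup : IsTopologicalAddGroup L
  continuous_bracket : Continuous fun p : L × L => ⁅p.1, p.2⁆

/-- `R` is an algebraically determined Polish Lie ring: it is a Polish Lie ring, and every
(abstract) Lie ring isomorphism from a Polish Lie ring onto `R` is a homeomorphism.
Lie ring homomorphisms are Lie algebra homomorphisms over `ℤ`. -/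
def IsAlgebraicallyDetermined (R : Type u) [LieRing R] [TopologicalSpace R] : Prop :=
  IsPolishLieRing R ∧
    ∀ (S : Type v) [LieRing S] [TopologicalSpace S], IsPolishLieRing S →
      ∀ φ : S ≃ₗ⁅ℤ⁆ R, IsHomeomorph φ

section Zero

variable {Ω : Opens ℂ}

/-- Extension by zero of a function on `Ω` to the whole plane. -/
noncomputable def extendZero (f : Ω → ℂ) : ℂ → ℂ :=
  open Classical in fun z => if h : z ∈ Ω then f ⟨z, h⟩ else 0

theorem extendZero_of_mem (f : Ω → ℂ) {z : ℂ} (h : z ∈ Ω) : extendZero f z = f ⟨z, h⟩ := by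
  simp [extendZero, h]

theorem extendZero_add (f g : Ω → ℂ) :
    extendZero (f + g) = extendZero f + extendZero g := by
  funext z; by_cases h : z ∈ Ω <;> simp [extendZero, h]

theorem extendZero_neg (f : Ω → ℂ) : extendZero (-f) = -extendZero f := by
  funext z; by_cases h : z ∈ Ω <;> simp [extendZero, h]

theorem extendZero_sub (f g : Ω → ℂ) :
    extendZero (f - g) = extendZero f - extendZero g := by
  funext z; by_cases h : z ∈ Ω <;> simp [extendZero, h]

theorem extendZero_mul (f g : Ω → ℂ) :
    extendZero (f * g) = extendZero f * extendZero g := by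
  funext z; by_cases h : z ∈ Ω <;> simp [extendZero, h]

theorem extendZero_zero : extendZero (0 : Ω → ℂ) = 0 := by
  funext z; by_cases h : z ∈ Ω <;> simp [extendZero, h]

end Zero

/-- The additive group of continuous functions `Ω → ℂ` that are holomorphic. -/
def analyticSubgroup (Ω : Opens ℂ) : AddSubgroup C(Ω, ℂ) where
  carrier := {f | DifferentiableOn ℂ (extendZero f) Ω}
  zero_mem' := by
    change DifferentiableOn ℂ (extendZero (0 : Ω → ℂ)) Ω
    rw [extendZero_zero]; exact differentiableOn_const 0
  add_mem' := by
    intro f g hf hg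
    change DifferentiableOn ℂ (extendZero ((f : Ω → ℂ) + (g : Ω → ℂ))) Ω
    rw [extendZero_add]; exact DifferentiableOn.add hf hg
  neg_mem' := by
    intro f hf
    change DifferentiableOn ℂ (extendZero (-(f : Ω → ℂ))) Ω
    rw [extendZero_neg]; exact DifferentiableOn.neg hf

/-- `𝒜(Ω)`: the analytic functions on the open set `Ω`. -/
def AnalyticFun (Ω : Opens ℂ) : Type := analyticSubgroup Ω

namespace AnalyticFun

variable {Ω : Opens ℂ}

/-- Pointwise addition. -/
noncomputable instance : AddCommGroup (AnalyticFun Ω) := inferInstanceAs (AddCommGroup (analyticSubgroup Ω))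

/-- The compact-open topology, i.e. uniform convergence on compact subsets of `Ω`. -/
noncomputable instance : TopologicalSpace (AnalyticFun Ω) :=
  inferInstanceAs (TopologicalSpace (analyticSubgroup Ω))

/-- The underlying continuous function. -/
def toContinuousMap (f : AnalyticFun Ω) : C(Ω, ℂ) :=
  Subtype.val (p := fun g => g ∈ analyticSubgroup Ω) f

noncomputable instance : CoeFun (AnalyticFun Ω) fun _ => Ω → ℂ := ⟨fun f => f.toContinuousMap⟩

theorem ext_fun {f g : AnalyticFun Ω} (h : ∀ z : Ω, f z = g z) : f = g :=
  Subtype.ext (ContinuousMap.ext h)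

theorem add_apply (f g : AnalyticFun Ω) (z : Ω) : (f + g) z = f z + g z := rfl

theorem zero_apply (z : Ω) : (0 : AnalyticFun Ω) z = 0 := rfl

theorem differentiableOn (f : AnalyticFun Ω) : DifferentiableOn ℂ (extendZero f) Ω := f.2

theorem differentiableAt (f : AnalyticFun Ω) (z : Ω) : DifferentiableAt ℂ (extendZero f) z :=
  f.differentiableOn.differentiableAt (Ω.isOpen.mem_nhds z.2)

/-- A holomorphic function on the plane near `Ω` restricts to an element of `𝒜(Ω)`. -/
noncomputable def ofDifferentiableOn (F : ℂ → ℂ) (hF : DifferentiableOn ℂ F Ω) : AnalyticFun Ω :=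
  ⟨⟨fun z => F z, hF.continuousOn.domRestrict⟩,
    hF.congr fun _ hz => extendZero_of_mem _ hz⟩

/-- The bracket `[f, g] = f g' - f' g`. -/
noncomputable instance : Bracket (AnalyticFun Ω) (AnalyticFun Ω) where
  bracket f g := ofDifferentiableOn
    (fun z => extendZero f z * deriv (extendZero g) z - deriv (extendZero f) z * extendZero g z)
    ((f.differentiableOn.mul (g.differentiableOn.deriv Ω.isOpen)).sub
      ((f.differentiableOn.deriv Ω.isOpen).mul g.differentiableOn))

theorem bracket_apply (f g : AnalyticFun Ω) (z : Ω) :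
    (⁅f, g⁆ : AnalyticFun Ω) z = f z * deriv (extendZero g) z - deriv (extendZero f) z * g z := by
  change extendZero f z * deriv (extendZero g) z - deriv (extendZero f) z * extendZero g z = _
  rw [extendZero_of_mem _ z.2, extendZero_of_mem _ z.2]

theorem deriv_add' (f g : AnalyticFun Ω) (z : Ω) :
    deriv (extendZero (f + g)) z = deriv (extendZero f) z + deriv (extendZero g) z := by
  rw [show extendZero (f + g : AnalyticFun Ω) = extendZero f + extendZero g from
    extendZero_add _ _]
  exact deriv_add (f.differentiableAt z) (g.differentiableAt z)

theorem deriv_bracket (f g : AnalyticFun Ω) (z : Ω) :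
    deriv (extendZero (⁅f, g⁆ : AnalyticFun Ω)) z =
      f z * deriv (deriv (extendZero g)) z - deriv (deriv (extendZero f)) z * g z := by
  have h : extendZero (⁅f, g⁆ : AnalyticFun Ω) =ᶠ[nhds (z : ℂ)] fun w =>
      extendZero f w * deriv (extendZero g) w - deriv (extendZero f) w * extendZero g w := by
    filter_upwards [Ω.isOpen.mem_nhds z.2] with w hw
    rw [extendZero_of_mem _ hw]; rfl
  have df := f.differentiableAt z
  have dg := g.differentiableAt z
  have df' := (f.differentiableOn.deriv Ω.isOpen).differentiableAt (Ω.isOpen.mem_nhds z.2)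
  have dg' := (g.differentiableOn.deriv Ω.isOpen).differentiableAt (Ω.isOpen.mem_nhds z.2)
  have key := ((df.hasDerivAt.mul dg'.hasDerivAt).sub (df'.hasDerivAt.mul dg.hasDerivAt)).deriv
  rw [h.deriv_eq]
  refine Eq.trans key ?_
  rw [extendZero_of_mem _ z.2, extendZero_of_mem _ z.2]
  ring

noncomputable instance : LieRing (AnalyticFun Ω) where
  add_lie f g h := ext_fun fun z => by
    simp only [add_apply, bracket_apply, deriv_add']; ring
  lie_add f g h := ext_fun fun z => by
    simp only [add_apply, bracket_apply, deriv_add']; ring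
  lie_self f := ext_fun fun z => by
    simp only [zero_apply, bracket_apply]; ring
  leibniz_lie f g h := ext_fun fun z => by
    simp only [add_apply, bracket_apply, deriv_bracket]; ring

end AnalyticFun

/-- The plane with the finitely many points `lam 0, …, lam (n - 1)` removed. -/
def puncturedPlane {n : ℕ} (lam : Fin n → ℂ) : Opens ℂ :=
  ⟨(Set.range lam)ᶜ, (Set.finite_range lam).isClosed.isOpen_compl⟩

/-! Fix `a` in a connected `Ω`. The bracket with `1` is differentiation, so its kernel is the
constants, and the difference quotient `g` of `f` at `a` is characterized by `f' = ((z - a) g)' = 2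
g + [z - a, g]`. This is a closed relation in any Polish Lie ring `S` isomorphic to `𝒜(Ω)`, so by
the closed graph theorem the difference quotient is continuous on `S`. The identity `3 f(a) = 2 f -
[z - a, f] + [(z - a) ^ 2, g]` makes evaluation at `a`, with values in the constants inside `S`,
continuous too, and hence every Taylor coefficient at `a`. Multiplication by `z - a` has a graph
described by these two operators, so it is also continuous.

It remains to see that the constants inside `S` carry the topology of `ℂ`. If large constants could
be arbitrarily small in `S`, a series `∑ c k (z - a) ^ k` with `k! ≤ ‖c k‖` could be made to
converge in `S`; its sum would correspond to an analytic function violating the Cauchy estimates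
(`not_forall_exists_large_const`). So the map from the constants in `S` to `ℂ` is continuous, and
open mapping gives its inverse (`continuous_symm_const`). By the identity theorem, equality of
Taylor coefficients then expresses the graph of the isomorphism as an intersection of closed sets;
closed graph and open mapping finish. -/

/-! ### Open mapping and closed graph theorems for abelian Polish groups. -/

open Filter Topology Set in
/-- Pettis' lemma: if `s` has the Baire property and is not meagre, then `s - s` is a neighbourhood
of zero. -/
theorem BaireMeasurableSet.exists_nhds_zero_sub {G : Type*} [AddCommGroup G] [TopologicalSpace G]
    [IsTopologicalAddGroup G] [BaireSpace G] {s : Set G} (hs : BaireMeasurableSet s)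
    (hm : ¬ IsMeagre s) : ∃ U ∈ 𝓝 (0 : G), ∀ x ∈ U, ∃ p ∈ s, ∃ q ∈ s, p - q = x := by
  obtain ⟨W, hW, hsW⟩ := hs.residualEq_isOpen
  have hne : W.Nonempty := by
    rw [nonempty_iff_ne_empty]
    rintro rfl
    apply hm
    filter_upwards [hsW] with y hy hys
    exact (hy.mp hys).elim
  obtain ⟨w, hw⟩ := hne
  refine ⟨(fun x => w + x) ⁻¹' W, ?_, fun x hx => ?_⟩
  · exact (hW.preimage (continuous_const_add w)).mem_nhds (by simpa using hw)
  have ht : Tendsto (fun y : G => y - x) (residual G) (residual G) :=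
    tendsto_residual_of_isOpenMap (continuous_sub_right x) (isOpenMap_sub_right x)
  have hd : Dense {y | (y ∈ s ↔ y ∈ W) ∧ (y - x ∈ s ↔ y - x ∈ W)} := by
    apply dense_of_mem_residual
    filter_upwards [hsW, ht.eventually hsW] with y h1 h2
    exact ⟨iff_of_eq h1, iff_of_eq h2⟩
  -- `W` meets its translate `W + x` in a nonempty open set, so a generic point there lies in both
  -- `s` and `s + x`.
  obtain ⟨y, hy, h1, h2⟩ := hd.inter_open_nonempty (W ∩ (fun y => y - x) ⁻¹' W)
    (hW.inter (hW.preimage (continuous_sub_right x))) ⟨w + x, hx, by simpa using hw⟩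
  exact ⟨y, h1.2 hy.1, y - x, h2.2 hy.2, by abel⟩

open Filter Topology Set in
/-- A continuous bijective homomorphism between Polish groups is open. -/
theorem AddMonoidHom.isOpenMap_of_polish {A B : Type*} [AddCommGroup A] [TopologicalSpace A]
    [IsTopologicalAddGroup A] [PolishSpace A] [AddCommGroup B] [TopologicalSpace B]
    [IsTopologicalAddGroup B] [PolishSpace B] (f : A →+ B) (hf : Continuous f)
    (hb : Function.Bijective f) : IsOpenMap f := by
  borelize A
  borelize B
  suffices H : ∀ U ∈ 𝓝 (0 : A), f '' U ∈ 𝓝 (0 : B) by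
    refine isOpenMap_iff_nhds_le.2 fun a => le_map fun U hU => ?_
    have h0 : (fun x => a + x) ⁻¹' U ∈ 𝓝 (0 : A) :=
      (continuous_const_add a).continuousAt.preimage_mem_nhds (by simpa using hU)
    have h1 := H _ h0
    have h2 : (fun y => y - f a) ⁻¹' (f '' ((fun x => a + x) ⁻¹' U)) ∈ 𝓝 (f a) :=
      (continuous_sub_right (f a)).continuousAt.preimage_mem_nhds (by simpa using h1)
    filter_upwards [h2] with y ⟨x, hx, hxy⟩
    exact ⟨a + x, hx, by rw [map_add, hxy]; exact add_sub_cancel _ _⟩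
  intro U hU
  have hsub : Tendsto (fun p : A × A => p.1 - p.2) (𝓝 0 ×ˢ 𝓝 0) (𝓝 0) := by
    simpa [nhds_prod_eq] using (continuous_sub (G := A)).tendsto (0, 0)
  obtain ⟨V', hV', hV'U⟩ := mem_prod_same_iff.1 (hsub hU)
  obtain ⟨V, hVV', hVo, hV0⟩ := mem_nhds_iff.1 hV'
  -- Lusin–Souslin: injective continuous images of Borel sets are Borel.
  have hmeas : MeasurableSet (f '' V) :=
    hVo.measurableSet.image_of_continuousOn_injOn hf.continuousOn hb.1.injOn
  have hnm : ¬ IsMeagre (f '' V) := by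
    intro hm
    -- Countably many translates of `V` cover `A`; if `f '' V` were meagre, so would be all of `B`.
    obtain ⟨s, hs, hcov⟩ := countable_cover_nhds (f := fun a : A => (fun x => x - a) ⁻¹' V)
      fun a => (continuous_sub_right a).continuousAt.preimage_mem_nhds
        (hVo.mem_nhds (by simpa using hV0))
    have key : ∀ᶠ y in residual B, ∀ a ∈ s, y - f a ∉ f '' V := by
      refine (eventually_countable_ball hs).2 fun a _ => ?_
      exact (tendsto_residual_of_isOpenMap (continuous_sub_right (f a))
        (isOpenMap_sub_right (f a))).eventually hm
    obtain ⟨y, hy⟩ := (dense_of_mem_residual key).nonempty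
    obtain ⟨x, rfl⟩ := hb.2 y
    have : x ∈ ⋃ a ∈ s, (fun x => x - a) ⁻¹' V := hcov ▸ mem_univ x
    simp only [mem_iUnion] at this
    obtain ⟨a, ha, hxa⟩ := this
    exact hy a ha ⟨x - a, hxa, map_sub f x a⟩
  obtain ⟨N, hN, hNs⟩ := hmeas.baireMeasurableSet.exists_nhds_zero_sub hnm
  filter_upwards [hN] with x hx
  obtain ⟨_, ⟨p, hp, rfl⟩, _, ⟨q, hq, rfl⟩, hpq⟩ := hNs x hx
  exact ⟨p - q, hV'U (mk_mem_prod (hVV' hp) (hVV' hq)), by rw [map_sub, hpq]⟩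

/-- The closed graph theorem for Polish groups. -/
theorem AddMonoidHom.continuous_of_isClosed_graph {A B : Type*} [AddCommGroup A]
    [TopologicalSpace A] [IsTopologicalAddGroup A] [PolishSpace A] [AddCommGroup B]
    [TopologicalSpace B] [IsTopologicalAddGroup B] [PolishSpace B] (f : A →+ B)
    (hf : IsClosed {p : A × B | f p.1 = p.2}) : Continuous f := by
  have hg : IsClosed (f.graph : Set (A × B)) := hf
  have : PolishSpace f.graph := hg.polishSpace
  let π : f.graph →+ A := (AddMonoidHom.fst A B).comp f.graph.subtype
  have hπ : Continuous π := continuous_fst.comp continuous_subtype_val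
  have hb : Function.Bijective π := by
    refine ⟨?_, fun a => ⟨⟨(a, f a), rfl⟩, rfl⟩⟩
    rintro ⟨⟨a, b⟩, (h : f a = b)⟩ ⟨⟨a', b'⟩, (h' : f a' = b')⟩ (e : a = a')
    subst e h h'
    rfl
  let e := (Equiv.ofBijective π hb).toHomeomorphOfContinuousOpen hπ (π.isOpenMap_of_polish hπ hb)
  have : (f : A → B) = fun a => (e.symm a : A × B).2 := by
    funext a
    have h1 : (e.symm a : A × B).1 = a := e.apply_symm_apply a
    have h2 : f (e.symm a : A × B).1 = (e.symm a : A × B).2 := (e.symm a).2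
    rw [← h2, h1]
  rw [this]
  exact continuous_snd.comp (continuous_subtype_val.comp e.symm.continuous)

/-! ### The Polish Lie ring structure on `𝒜(Ω)`. -/

namespace AnalyticFun

variable {Ω : Opens ℂ}

instance : LocallyCompactSpace Ω := Ω.isOpen.locallyCompactSpace

instance : IsTopologicalAddGroup (AnalyticFun Ω) :=
  inferInstanceAs (IsTopologicalAddGroup (analyticSubgroup Ω))

theorem continuous_toContinuousMap : Continuous (toContinuousMap : AnalyticFun Ω → C(Ω, ℂ)) :=
  continuous_subtype_val

theorem isInducing_toContinuousMap :
    Topology.IsInducing (toContinuousMap : AnalyticFun Ω → C(Ω, ℂ)) :=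
  Topology.IsInducing.subtypeVal

theorem continuous_eval (z : Ω) : Continuous fun f : AnalyticFun Ω => f z :=
  (continuous_eval_const z).comp continuous_toContinuousMap

open Filter Topology in
theorem tendstoLocallyUniformlyOn_extendZero {ι : Type*} {l : Filter ι} {F : ι → C(Ω, ℂ)}
    {f : C(Ω, ℂ)} (h : Tendsto F l (𝓝 f)) :
    TendstoLocallyUniformlyOn (fun i => extendZero (F i)) (extendZero f) l Ω := by
  rw [tendstoLocallyUniformlyOn_iff_tendstoLocallyUniformly_comp_coe]
  have h1 := ContinuousMap.tendsto_iff_tendstoLocallyUniformly.1 h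
  have h2 : ∀ g : C(Ω, ℂ), extendZero g ∘ (fun z : Ω => (z : ℂ)) = g := fun g =>
    funext fun z => extendZero_of_mem g z.2
  have h3 : (fun i => extendZero (F i) ∘ (fun z : Ω => (z : ℂ))) = fun i => ⇑(F i) :=
    funext fun i => h2 (F i)
  change TendstoLocallyUniformly (fun i => extendZero (F i) ∘ (fun z : Ω => (z : ℂ)))
    (extendZero f ∘ (fun z : Ω => (z : ℂ))) l
  rw [h2, h3]
  exact h1

/-- Weierstrass: locally uniform limits of holomorphic functions are holomorphic. -/
theorem isClosed_analyticSubgroup : IsClosed (analyticSubgroup Ω : Set C(Ω, ℂ)) := by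
  refine isClosed_iff_clusterPt.2 fun f hf => ?_
  have : (nhdsWithin f (analyticSubgroup Ω : Set C(Ω, ℂ))).NeBot := hf
  have h := tendstoLocallyUniformlyOn_extendZero
    (Filter.tendsto_id.mono_left (nhdsWithin_le_nhds (a := f)
      (s := (analyticSubgroup Ω : Set C(Ω, ℂ)))))
  exact h.differentiableOn (Filter.eventually_of_mem self_mem_nhdsWithin fun g hg => hg) Ω.isOpen

instance : PolishSpace (AnalyticFun Ω) := by
  have : PolishSpace C(Ω, ℂ) := inferInstance
  exact isClosed_analyticSubgroup.polishSpace

/-- The derivative of an analytic function. -/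
noncomputable def derivative (f : AnalyticFun Ω) : AnalyticFun Ω :=
  ofDifferentiableOn (deriv (extendZero f)) (f.differentiableOn.deriv Ω.isOpen)

theorem continuous_derivative : Continuous (derivative : AnalyticFun Ω → AnalyticFun Ω) := by
  rw [isInducing_toContinuousMap.continuous_iff, continuous_iff_continuousAt]
  intro f
  refine ContinuousMap.tendsto_iff_tendstoLocallyUniformly.2 ?_
  have h := (tendstoLocallyUniformlyOn_extendZero
    (continuous_toContinuousMap.tendsto f)).deriv
    (Filter.Eventually.of_forall fun g => g.differentiableOn) Ω.isOpen
  rw [tendstoLocallyUniformlyOn_iff_tendstoLocallyUniformly_comp_coe] at h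
  exact h

theorem isPolishLieRing : IsPolishLieRing (AnalyticFun Ω) where
  polish := inferInstance
  topologicalAddGroup := inferInstance
  continuous_bracket := by
    rw [isInducing_toContinuousMap.continuous_iff]
    have h0 := continuous_toContinuousMap (Ω := Ω)
    have h1 := h0.comp continuous_derivative
    have : (toContinuousMap ∘ fun p : AnalyticFun Ω × AnalyticFun Ω => ⁅p.1, p.2⁆) = fun p =>
        p.1.toContinuousMap * p.2.derivative.toContinuousMap -
          p.1.derivative.toContinuousMap * p.2.toContinuousMap := by
      funext p
      exact ContinuousMap.ext fun z => bracket_apply p.1 p.2 z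
    rw [this]
    exact ((h0.comp continuous_fst).mul (h1.comp continuous_snd)).sub
      ((h1.comp continuous_fst).mul (h0.comp continuous_snd))

end AnalyticFun

/-! ### Difference quotients, bracket identities and Taylor coefficients. -/

namespace AnalyticFun

variable {Ω : Opens ℂ}

theorem extendZero_apply (f : AnalyticFun Ω) (z : Ω) : extendZero f z = f z :=
  extendZero_of_mem _ z.2

theorem sub_apply (f g : AnalyticFun Ω) (z : Ω) : (f - g) z = f z - g z := rfl

theorem deriv_extendZero_ofDifferentiableOn {F : ℂ → ℂ} (hF : DifferentiableOn ℂ F Ω) (z : Ω) :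
    deriv (extendZero (ofDifferentiableOn F hF)) z = deriv F z := by
  apply Filter.EventuallyEq.deriv_eq
  filter_upwards [Ω.isOpen.mem_nhds z.2] with w hw
  exact extendZero_of_mem _ hw

/-- Constant functions. -/
noncomputable def const (Ω : Opens ℂ) : ℂ →+ AnalyticFun Ω where
  toFun c := ofDifferentiableOn (fun _ => c) (differentiableOn_const c)
  map_zero' := rfl
  map_add' _ _ := rfl

/-- The function `z ↦ z - a`. -/
noncomputable def coord (Ω : Opens ℂ) (a : ℂ) : AnalyticFun Ω :=
  ofDifferentiableOn (fun z => z - a) (by fun_prop)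

/-- The function `z ↦ (z - a) ^ 2`. -/
noncomputable def coordSq (Ω : Opens ℂ) (a : ℂ) : AnalyticFun Ω :=
  ofDifferentiableOn (fun z => (z - a) ^ 2) (by fun_prop)

/-- Multiplication by `z - a`. -/
noncomputable def mulCoord (a : ℂ) : AnalyticFun Ω →+ AnalyticFun Ω where
  toFun f := ofDifferentiableOn (fun z => (z - a) * extendZero f z)
    (DifferentiableOn.mul (by fun_prop) f.differentiableOn)
  map_zero' := ext_fun fun z => by
    change ((z : ℂ) - a) * extendZero (0 : AnalyticFun Ω) z = 0
    rw [extendZero_apply, zero_apply, mul_zero]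
  map_add' f g := ext_fun fun z => by
    change ((z : ℂ) - a) * extendZero (f + g : AnalyticFun Ω) z =
      ((z : ℂ) - a) * extendZero f z + ((z : ℂ) - a) * extendZero g z
    rw [extendZero_apply, extendZero_apply, extendZero_apply, add_apply, mul_add]

/-- The difference quotient `z ↦ (f z - f a) / (z - a)`. -/
noncomputable def divCoordFun (a : Ω) (f : AnalyticFun Ω) : AnalyticFun Ω :=
  ofDifferentiableOn (dslope (extendZero f) a)
    ((Complex.differentiableOn_dslope (Ω.isOpen.mem_nhds a.2)).2 f.differentiableOn)

theorem const_apply (c : ℂ) (z : Ω) : const Ω c z = c := rfl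

theorem mulCoord_apply (a : ℂ) (f : AnalyticFun Ω) (z : Ω) :
    mulCoord a f z = (z - a) * f z := by
  rw [← extendZero_apply f]; rfl

theorem deriv_const (c : ℂ) (z : Ω) : deriv (extendZero (const Ω c)) z = 0 :=
  (deriv_extendZero_ofDifferentiableOn _ z).trans (by simp)

theorem deriv_coord (a : ℂ) (z : Ω) : deriv (extendZero (coord Ω a)) z = 1 :=
  (deriv_extendZero_ofDifferentiableOn _ z).trans (by simp)

theorem deriv_coordSq (a : ℂ) (z : Ω) : deriv (extendZero (coordSq Ω a)) z = 2 * (z - a) :=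
  (deriv_extendZero_ofDifferentiableOn _ z).trans (by
    have : HasDerivAt (fun w : ℂ => (w - a) ^ 2) _ (z : ℂ) :=
      ((hasDerivAt_id (z : ℂ)).sub_const a).pow 2
    rw [this.deriv]; simp)

theorem deriv_mulCoord (a : ℂ) (f : AnalyticFun Ω) (z : Ω) :
    deriv (extendZero (mulCoord a f)) z = f z + (z - a) * deriv (extendZero f) z :=
  (deriv_extendZero_ofDifferentiableOn _ z).trans (by
    have := (((hasDerivAt_id (z : ℂ)).sub_const a).mul (f.differentiableAt z).hasDerivAt).deriv
    refine this.trans ?_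
    rw [extendZero_apply]; simp)

theorem const_one_lie_apply (f : AnalyticFun Ω) (z : Ω) :
    (⁅const Ω 1, f⁆ : AnalyticFun Ω) z = deriv (extendZero f) z := by
  rw [bracket_apply, deriv_const, const_apply]; ring

theorem coord_lie_apply (a : ℂ) (f : AnalyticFun Ω) (z : Ω) :
    (⁅coord Ω a, f⁆ : AnalyticFun Ω) z = (z - a) * deriv (extendZero f) z - f z := by
  rw [bracket_apply, deriv_coord, one_mul]; rfl

theorem coordSq_lie_apply (a : ℂ) (f : AnalyticFun Ω) (z : Ω) :
    (⁅coordSq Ω a, f⁆ : AnalyticFun Ω) z =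
      (z - a) ^ 2 * deriv (extendZero f) z - 2 * (z - a) * f z := by
  rw [bracket_apply, deriv_coordSq]; rfl

theorem const_one_lie_const (c : ℂ) : ⁅const Ω 1, const Ω c⁆ = 0 :=
  ext_fun fun z => by rw [const_one_lie_apply, deriv_const]; rfl

theorem const_one_lie_mulCoord (a : ℂ) (f : AnalyticFun Ω) :
    ⁅const Ω 1, mulCoord a f⁆ = f + f + ⁅coord Ω a, f⁆ :=
  ext_fun fun z => by
    rw [const_one_lie_apply, deriv_mulCoord, add_apply, add_apply, coord_lie_apply]; ring

/-- On a connected open set the functions commuting with `1` are the constants. -/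
theorem eq_const_of_lie_eq_zero (hΩ : IsPreconnected (Ω : Set ℂ)) (a : Ω) {f : AnalyticFun Ω}
    (hf : ⁅const Ω 1, f⁆ = 0) : f = const Ω (f a) := by
  refine ext_fun fun z => ?_
  rw [const_apply, ← extendZero_apply, ← extendZero_apply]
  refine Ω.isOpen.is_const_of_deriv_eq_zero hΩ f.differentiableOn (fun w hw => ?_) z.2 a.2
  rw [← const_one_lie_apply f ⟨w, hw⟩, hf]; rfl

theorem eq_const_add_mulCoord (a : Ω) (f : AnalyticFun Ω) :
    f = const Ω (f a) + mulCoord a (divCoordFun a f) := by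
  refine ext_fun fun z => ?_
  rw [add_apply, const_apply, mulCoord_apply, ← extendZero_apply f, ← extendZero_apply f]
  have := sub_smul_dslope (extendZero f) (a : ℂ) (z : ℂ)
  rw [smul_eq_mul] at this
  change _ = _ + ((z : ℂ) - a) * dslope (extendZero f) a z
  rw [this]; ring

theorem mulCoord_injective (a : Ω) :
    Function.Injective (mulCoord a : AnalyticFun Ω → AnalyticFun Ω) := by
  rw [injective_iff_map_eq_zero]
  intro f hf
  have h0 : ∀ z : Ω, (z : ℂ) ≠ a → f z = 0 := fun z hz => by
    have : mulCoord a f z = 0 := by rw [hf]; rfl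
    rw [mulCoord_apply] at this
    exact (mul_eq_zero.1 this).resolve_left (sub_ne_zero.2 hz)
  refine ext_fun fun z => ?_
  -- At `a` itself nothing can be cancelled, but the derivative of `(z - a) f` there is `f a`.
  by_cases hz : (z : ℂ) = a
  · have h1 : deriv (extendZero (mulCoord a f)) z = 0 := by
      rw [← const_one_lie_apply, hf, lie_zero]; rfl
    rw [deriv_mulCoord, hz, sub_self, zero_mul, add_zero] at h1
    exact h1
  · exact h0 z hz

theorem eq_divCoordFun (a : Ω) {f g : AnalyticFun Ω} {c : ℂ} (h : f = const Ω c + mulCoord a g) :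
    g = divCoordFun a f := by
  have h1 := eq_const_add_mulCoord a f
  have hc : f a = c := by
    rw [h, add_apply, const_apply, mulCoord_apply, sub_self, zero_mul, add_zero]
  rw [hc] at h1
  exact mulCoord_injective a (add_left_cancel (h.symm.trans h1))

/-- The difference quotient at `a`, as an additive map. -/
noncomputable def divCoord (a : Ω) : AnalyticFun Ω →+ AnalyticFun Ω :=
  AddMonoidHom.mk' (divCoordFun a) fun f g => by
    refine (eq_divCoordFun a (c := f a + g a) ?_).symm
    rw [map_add, map_add]
    conv_lhs => rw [eq_const_add_mulCoord a f, eq_const_add_mulCoord a g]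
    abel

theorem const_add_mulCoord_divCoord (a : Ω) (f : AnalyticFun Ω) :
    const Ω (f a) + mulCoord a (divCoord a f) = f :=
  (eq_const_add_mulCoord a f).symm

theorem divCoord_const_add_mulCoord (a : Ω) (c : ℂ) (g : AnalyticFun Ω) :
    divCoord a (const Ω c + mulCoord a g) = g :=
  (eq_divCoordFun a rfl).symm

theorem divCoord_mulCoord (a : Ω) (g : AnalyticFun Ω) : divCoord a (mulCoord a g) = g := by
  simpa using divCoord_const_add_mulCoord a 0 g

theorem divCoord_const (a : Ω) (c : ℂ) : divCoord a (const Ω c) = 0 := by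
  simpa using divCoord_const_add_mulCoord a c 0

/-- A characterization of the difference quotient in terms of brackets. -/
theorem divCoord_eq_iff (hΩ : IsPreconnected (Ω : Set ℂ)) (a : Ω) (f g : AnalyticFun Ω) :
    divCoord a f = g ↔ ⁅const Ω 1, f⁆ = g + g + ⁅coord Ω a, g⁆ := by
  constructor
  · rintro rfl
    conv_lhs => rw [← const_add_mulCoord_divCoord a f]
    rw [lie_add, const_one_lie_const, zero_add, const_one_lie_mulCoord]
  · intro h
    rw [← const_one_lie_mulCoord, ← sub_eq_zero, ← lie_sub] at h
    have := eq_const_of_lie_eq_zero hΩ a h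
    rw [sub_eq_iff_eq_add] at this
    exact (eq_divCoordFun a this).symm

/-- The value at `a` in terms of brackets and the difference quotient. -/
theorem const_three_mul_apply (a : Ω) (f : AnalyticFun Ω) :
    const Ω (3 * f a) = f + f - ⁅coord Ω a, f⁆ + ⁅coordSq Ω a, divCoord a f⁆ := by
  refine ext_fun fun z => ?_
  have h := const_add_mulCoord_divCoord a f
  have h0 : f a + (z - a) * divCoord a f z = f z := by
    conv_rhs => rw [← h]
    rw [add_apply, const_apply, mulCoord_apply]
  have h1 : divCoord a f z + (z - a) * deriv (extendZero (divCoord a f)) z =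
      deriv (extendZero f) z := by
    conv_rhs => rw [← h]
    rw [deriv_add', deriv_const, deriv_mulCoord, zero_add]
  rw [const_apply, add_apply, sub_apply, add_apply, coord_lie_apply, coordSq_lie_apply, ← h1, ← h0]
  ring

/-- Multiplication by `z - a` inverts the difference quotient on functions vanishing at `a`. The
vanishing is phrased through `const Ω (3 * f a)` because that is what brackets express. -/
theorem mulCoord_eq_iff (a : Ω) (f g : AnalyticFun Ω) :
    mulCoord a g = f ↔ divCoord a f = g ∧ const Ω (3 * f a) = 0 := by
  constructor
  · rintro rfl
    refine ⟨divCoord_mulCoord a g, ?_⟩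
    rw [mulCoord_apply, sub_self, zero_mul, mul_zero, map_zero]
  · rintro ⟨rfl, h⟩
    have h3 : 3 * f a = 0 := congrArg (fun k : AnalyticFun Ω => k a) h
    have h0 : f a = 0 := by simpa using h3
    have := const_add_mulCoord_divCoord a f
    rwa [h0, map_zero, zero_add] at this

/-- Taylor coefficients at `a`. -/
noncomputable def taylorCoeff (a : Ω) (n : ℕ) : AnalyticFun Ω →+ ℂ :=
  AddMonoidHom.mk' (fun f => ((divCoord a)^[n] f) a) fun f g => by
    rw [iterate_map_add, add_apply]

theorem taylorCoeff_apply (a : Ω) (n : ℕ) (f : AnalyticFun Ω) :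
    taylorCoeff a n f = ((divCoord a)^[n] f) a := rfl

theorem taylorCoeff_monomial (a : Ω) (n k : ℕ) (c : ℂ) :
    taylorCoeff a k ((mulCoord a)^[n] (const Ω c)) = if k = n then c else 0 := by
  induction k generalizing n with
  | zero =>
    cases n with
    | zero => simp [taylorCoeff_apply, const_apply]
    | succ n =>
      rw [taylorCoeff_apply, Function.iterate_zero_apply, Function.iterate_succ_apply',
        mulCoord_apply]
      simp
  | succ k ih =>
    cases n with
    | zero =>
      rw [taylorCoeff_apply, Function.iterate_succ_apply, Function.iterate_zero_apply,
        divCoord_const, iterate_map_zero]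
      simp [zero_apply]
    | succ n =>
      have := ih n
      rw [taylorCoeff_apply] at this
      rw [taylorCoeff_apply, Function.iterate_succ_apply, Function.iterate_succ_apply',
        divCoord_mulCoord, this]
      simp

/-- On the circle of radius `r` the quotient `(f w - f a) / (w - a)` is at most `2 * C / r`; the
maximum principle carries the bound inside. -/
theorem norm_divCoord_le {a : Ω} {r : ℝ} (hr : 0 < r) (hball : Metric.closedBall (a : ℂ) r ⊆ Ω)
    {f : AnalyticFun Ω} {C : ℝ} (hf : ∀ z ∈ Metric.closedBall (a : ℂ) r, ‖extendZero f z‖ ≤ C)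
    {z : ℂ} (hz : z ∈ Metric.closedBall (a : ℂ) r) :
    ‖extendZero (divCoord a f) z‖ ≤ C * (2 / r) := by
  have hcl : closure (Metric.ball (a : ℂ) r) = Metric.closedBall (a : ℂ) r := closure_ball _ hr.ne'
  have hd : DiffContOnCl ℂ (extendZero (divCoord a f)) (Metric.ball (a : ℂ) r) := by
    apply DifferentiableOn.diffContOnCl
    rw [hcl]
    exact (divCoord a f).differentiableOn.mono hball
  refine Complex.norm_le_of_forall_mem_frontier_norm_le Metric.isBounded_ball hd (fun w hw => ?_)
    (hcl ▸ hz)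
  rw [frontier_ball _ hr.ne'] at hw
  have hwb : w ∈ Metric.closedBall (a : ℂ) r := Metric.sphere_subset_closedBall hw
  have h0 : f a + (w - a) * divCoord a f ⟨w, hball hwb⟩ = f ⟨w, hball hwb⟩ := by
    conv_rhs => rw [← const_add_mulCoord_divCoord a f]
    rw [add_apply, const_apply, mulCoord_apply]
  rw [← extendZero_apply, ← extendZero_apply, ← extendZero_apply] at h0
  have h1 : ‖w - a‖ = r := by simpa [dist_eq_norm] using hw
  have h2 : ‖(w - a) * extendZero (divCoord a f) w‖ ≤ C + C := by
    rw [show (w - a) * extendZero (divCoord a f) w = extendZero f w - extendZero f a from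
      eq_sub_of_add_eq' h0]
    exact (norm_sub_le _ _).trans
      (add_le_add (hf w hwb) (hf a (Metric.mem_closedBall_self hr.le)))
  rw [norm_mul, h1] at h2
  rw [mul_div_assoc', le_div_iff₀ hr]
  linarith

/-- A Cauchy estimate for iterated difference quotients. -/
theorem exists_norm_iterate_divCoord_le (a : Ω) : ∃ r : ℝ, 0 < r ∧
    Metric.closedBall (a : ℂ) r ⊆ Ω ∧ ∀ f : AnalyticFun Ω, ∃ C : ℝ, ∀ n : ℕ,
      ∀ z ∈ Metric.closedBall (a : ℂ) r,
        ‖extendZero ((divCoord a)^[n] f : AnalyticFun Ω) z‖ ≤ C * (2 / r) ^ n := by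
  obtain ⟨r, hr, hball⟩ := Metric.nhds_basis_closedBall.mem_iff.1 (Ω.isOpen.mem_nhds a.2)
  refine ⟨r, hr, hball, fun f => ?_⟩
  obtain ⟨C, hC⟩ := (isCompact_closedBall (a : ℂ) r).exists_bound_of_continuousOn
    (f.differentiableOn.continuousOn.mono hball)
  refine ⟨C, fun n => ?_⟩
  induction n with
  | zero => simpa using hC
  | succ n ih =>
    intro z hz
    rw [Function.iterate_succ_apply', pow_succ, ← mul_assoc]
    exact norm_divCoord_le hr hball ih hz

theorem exists_norm_taylorCoeff_le (a : Ω) (f : AnalyticFun Ω) :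
    ∃ C M : ℝ, ∀ n, ‖taylorCoeff a n f‖ ≤ C * M ^ n := by
  obtain ⟨r, hr, -, h⟩ := exists_norm_iterate_divCoord_le a
  obtain ⟨C, hC⟩ := h f
  refine ⟨C, 2 / r, fun n => ?_⟩
  have := hC n a (Metric.mem_closedBall_self hr.le)
  rwa [extendZero_apply] at this

/-- An analytic function on a connected open set is determined by its Taylor coefficients. -/
theorem eq_zero_of_taylorCoeff_eq_zero (hΩ : IsPreconnected (Ω : Set ℂ)) (a : Ω)
    {f : AnalyticFun Ω} (hf : ∀ n, taylorCoeff a n f = 0) : f = 0 := by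
  obtain ⟨r, hr, hball, h⟩ := exists_norm_iterate_divCoord_le a
  obtain ⟨C, hC⟩ := h f
  have key : ∀ (n : ℕ) (z : Ω), f z = (z - a) ^ n * ((divCoord a)^[n] f) z := by
    intro n z
    induction n with
    | zero => simp
    | succ n ih =>
      rw [ih]
      have h1 := const_add_mulCoord_divCoord a ((divCoord a)^[n] f)
      have h2 := hf n
      rw [taylorCoeff_apply] at h2
      rw [h2, map_zero, zero_add] at h1
      conv_lhs => rw [← h1]
      rw [mulCoord_apply, Function.iterate_succ_apply', pow_succ, mul_assoc]
  -- The radius `r / 2` makes `‖z - a‖ * (2 / r) < 1`, so the remainder bound tends to zero.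
  have hnear : ∀ z ∈ Metric.ball (a : ℂ) (r / 2), extendZero f z = 0 := by
    intro z hz
    have hz' : z ∈ Metric.closedBall (a : ℂ) r :=
      Metric.ball_subset_closedBall (Metric.ball_subset_ball (by linarith) hz)
    rw [Metric.mem_ball, dist_eq_norm] at hz
    have hq : ‖z - a‖ * (2 / r) < 1 := by
      rw [mul_div_assoc', div_lt_one hr]; linarith
    have hb : ∀ n : ℕ, ‖extendZero f z‖ ≤ C * (‖z - a‖ * (2 / r)) ^ n := fun n => by
      have h1 := key n ⟨z, hball hz'⟩
      rw [← extendZero_apply, ← extendZero_apply] at h1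
      rw [h1, norm_mul, norm_pow, mul_pow, mul_left_comm]
      exact mul_le_mul_of_nonneg_left (hC n z hz') (by positivity)
    have ht := (tendsto_pow_atTop_nhds_zero_of_lt_one
      (mul_nonneg (norm_nonneg (z - a)) (by positivity)) hq).const_mul C
    rw [mul_zero] at ht
    exact norm_le_zero_iff.1 (ge_of_tendsto' ht hb)
  have heq : Set.EqOn (extendZero f) 0 Ω :=
    (f.differentiableOn.analyticOnNhd Ω.isOpen).eqOn_zero_of_preconnected_of_eventuallyEq_zero hΩ
      a.2 (Filter.eventually_of_mem (Metric.ball_mem_nhds _ (half_pos hr)) hnear)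
  refine ext_fun fun z => ?_
  rw [← extendZero_apply]
  exact heq z.2

end AnalyticFun

/-! ### Continuity of the transported operators on an isomorphic Polish Lie ring. -/

namespace AnalyticFun

variable {Ω : Opens ℂ}

section Transport

variable {S : Type*} [LieRing S]

/-- The additive map of `S` corresponding to `T` under an isomorphism `S ≃ 𝒜(Ω)`. -/
noncomputable def transport (φ : S ≃ₗ⁅ℤ⁆ AnalyticFun Ω) (T : AnalyticFun Ω →+ AnalyticFun Ω) :
    S →+ S :=
  AddMonoidHom.mk' (fun x => φ.symm (T (φ x))) fun x y => by rw [map_add, map_add, map_add]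

theorem transport_apply (φ : S ≃ₗ⁅ℤ⁆ AnalyticFun Ω) (T : AnalyticFun Ω →+ AnalyticFun Ω) (x : S) :
    transport φ T x = φ.symm (T (φ x)) := rfl

/-- The map `f ↦ 3 f(a)`, with values in the constant functions. -/
noncomputable def constEval (a : Ω) : AnalyticFun Ω →+ AnalyticFun Ω :=
  AddMonoidHom.mk' (fun f => const Ω (3 * f a)) fun f g => by
    rw [add_apply, mul_add, map_add]

theorem constEval_apply (a : Ω) (f : AnalyticFun Ω) : constEval a f = const Ω (3 * f a) := rfl

theorem transport_iterate (φ : S ≃ₗ⁅ℤ⁆ AnalyticFun Ω) (T : AnalyticFun Ω →+ AnalyticFun Ω) (n : ℕ)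
    (x : S) : (transport φ T)^[n] x = φ.symm (T^[n] (φ x)) := by
  induction n with
  | zero => exact (φ.symm_apply_apply x).symm
  | succ n ih =>
    rw [Function.iterate_succ_apply', ih, transport_apply, φ.apply_symm_apply,
      Function.iterate_succ_apply']

variable [TopologicalSpace S]

/-- By `divCoord_eq_iff` the graph is cut out by an equation in brackets and sums, which an abstract
isomorphism preserves; hence it is closed. -/
theorem continuous_transport_divCoord (hS : IsPolishLieRing S)
    (hΩ : IsPreconnected (Ω : Set ℂ)) (a : Ω) (φ : S ≃ₗ⁅ℤ⁆ AnalyticFun Ω) : Continuous (transport φ (divCoord a)) := by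
  have := hS.polish
  have := hS.topologicalAddGroup
  have hlie : ∀ {X : Type _} [TopologicalSpace X] {f g : X → S}, Continuous f → Continuous g →
    Continuous fun x => ⁅f x, g x⁆ := fun hf hg => hS.continuous_bracket.comp (hf.prodMk hg)
  apply AddMonoidHom.continuous_of_isClosed_graph
  have : {p : S × S | transport φ (divCoord a) p.1 = p.2} = {p : S × S |
      ⁅φ.symm (const Ω 1), p.1⁆ = p.2 + p.2 + ⁅φ.symm (coord Ω a), p.2⁆} := by
    ext p
    rw [Set.mem_ofPred_eq, Set.mem_ofPred_eq, transport_apply, φ.symm_apply_eq,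
      divCoord_eq_iff hΩ, ← (EquivLike.injective φ).eq_iff]
    simp only [LieEquiv.map_lie, map_add, φ.apply_symm_apply]
  rw [this]
  exact isClosed_eq (hlie continuous_const continuous_fst)
    ((continuous_snd.add continuous_snd).add (hlie continuous_const continuous_snd))

theorem continuous_transport_constEval (hS : IsPolishLieRing S)
    (hΩ : IsPreconnected (Ω : Set ℂ)) (a : Ω) (φ : S ≃ₗ⁅ℤ⁆ AnalyticFun Ω) : Continuous (transport φ (constEval a)) := by
  have := hS.polish
  have := hS.topologicalAddGroup
  have hlie : ∀ {X : Type _} [TopologicalSpace X] {f g : X → S}, Continuous f → Continuous g →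
    Continuous fun x => ⁅f x, g x⁆ := fun hf hg => hS.continuous_bracket.comp (hf.prodMk hg)
  have : (transport φ (constEval a) : S → S) = fun x =>
      x + x - ⁅φ.symm (coord Ω a), x⁆ + ⁅φ.symm (coordSq Ω a), transport φ (divCoord a) x⁆ := by
    funext x
    rw [transport_apply, φ.symm_apply_eq, constEval_apply, const_three_mul_apply]
    simp only [LieEquiv.map_lie, map_add, map_sub, φ.apply_symm_apply, transport_apply]
  rw [this]
  exact ((continuous_id.add continuous_id).sub (hlie continuous_const continuous_id)).add
    (hlie continuous_const (continuous_transport_divCoord hS hΩ a φ))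

theorem continuous_transport_mulCoord (hS : IsPolishLieRing S)
    (hΩ : IsPreconnected (Ω : Set ℂ)) (a : Ω) (φ : S ≃ₗ⁅ℤ⁆ AnalyticFun Ω) : Continuous (transport φ (mulCoord (a : ℂ))) := by
  have := hS.polish
  have := hS.topologicalAddGroup
  apply AddMonoidHom.continuous_of_isClosed_graph
  have : {p : S × S | transport φ (mulCoord (a : ℂ)) p.1 = p.2} = {p : S × S |
      transport φ (divCoord a) p.2 = p.1 ∧ transport φ (constEval a) p.2 = 0} := by
    ext p
    rw [Set.mem_ofPred_eq, Set.mem_ofPred_eq, transport_apply, transport_apply, transport_apply,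
      φ.symm_apply_eq, φ.symm_apply_eq, φ.symm_apply_eq, map_zero, constEval_apply, mulCoord_eq_iff]
  rw [this]
  exact (isClosed_eq ((continuous_transport_divCoord hS hΩ a φ).comp continuous_snd)
    continuous_fst).inter (isClosed_eq ((continuous_transport_constEval hS hΩ a φ).comp
      continuous_snd) continuous_const)

/-- Taylor coefficients depend continuously on the element of `S`, when viewed in `S`. -/
theorem continuous_symm_const_taylorCoeff (hS : IsPolishLieRing S)
    (hΩ : IsPreconnected (Ω : Set ℂ)) (a : Ω) (φ : S ≃ₗ⁅ℤ⁆ AnalyticFun Ω) (n : ℕ) :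
    Continuous fun x : S => φ.symm (const Ω (3 * taylorCoeff a n (φ x))) := by
  have h := (continuous_transport_constEval hS hΩ a φ).comp
    ((continuous_transport_divCoord hS hΩ a φ).iterate n)
  refine h.congr fun x => ?_
  rw [Function.comp_apply, transport_iterate, transport_apply, φ.apply_symm_apply]
  rfl

open Filter Topology in
/-- Constants of arbitrarily large modulus cannot be arbitrarily small in `S`: otherwise some
analytic function would have Taylor coefficients with `k! ≤ ‖c k‖`. -/
theorem not_forall_exists_large_const (hS : IsPolishLieRing S)
    (hΩ : IsPreconnected (Ω : Set ℂ)) (a : Ω) (φ : S ≃ₗ⁅ℤ⁆ AnalyticFun Ω) :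
    ¬ ∀ U ∈ 𝓝 (0 : S), ∀ R : ℝ, ∃ c : ℂ, φ.symm (const Ω c) ∈ U ∧ R ≤ ‖c‖ := by
  intro H
  have := hS.polish
  have := hS.topologicalAddGroup
  let _ := upgradeIsCompletelyMetrizable S
  let m : ℕ → ℂ → S := fun k c => φ.symm ((mulCoord (a : ℂ))^[k] (const Ω c))
  -- Multiplication by `(z - a) ^ k` is continuous on `S`, so a large constant close enough to zero
  -- moves `s` by less than `(1 / 2) ^ k`.
  have step : ∀ (k : ℕ) (s : S), ∃ c : ℂ, (k.factorial : ℝ) ≤ ‖c‖ ∧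
      dist s (s + m k c) < (1 / 2) ^ k := by
    intro k s
    have hc : Continuous fun x : S => s + (transport φ (mulCoord (a : ℂ)))^[k] x :=
      continuous_const.add ((continuous_transport_mulCoord hS hΩ a φ).iterate k)
    have h0 : (fun x : S => s + (transport φ (mulCoord (a : ℂ)))^[k] x) 0 = s := by
      simp [iterate_map_zero]
    have hU := hc.continuousAt.preimage_mem_nhds
      (h0.symm ▸ Metric.ball_mem_nhds s (show (0 : ℝ) < (1 / 2) ^ k by positivity))
    obtain ⟨c, hcU, hc⟩ := H _ hU k.factorial
    refine ⟨c, hc, ?_⟩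
    rw [Set.mem_preimage, transport_iterate, φ.apply_symm_apply, Metric.mem_ball, dist_comm, h0] at hcU
    exact hcU
  choose c hc hd using step
  let s : ℕ → S := fun n => Nat.rec 0 (fun k x => x + m k (c k x)) n
  have hs : ∀ n, s (n + 1) = s n + m n (c n (s n)) := fun n => rfl
  have hcauchy : CauchySeq s := cauchySeq_of_le_geometric (1 / 2) 1 (by norm_num) fun n => by
    rw [one_mul, hs]; exact (hd n (s n)).le
  obtain ⟨l, hl⟩ := cauchySeq_tendsto_of_complete hcauchy
  have hcoef0 : ∀ n k, n ≤ k → taylorCoeff a k (φ (s n)) = 0 := by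
    intro n
    induction n with
    | zero => intro k _; rw [show s 0 = 0 from rfl, map_zero, map_zero]
    | succ n ih =>
      intro k hk
      rw [hs, map_add, map_add, ih k (by omega), φ.apply_symm_apply, taylorCoeff_monomial,
        if_neg (by omega), add_zero]
  have hcoef : ∀ k n, k < n → taylorCoeff a k (φ (s n)) = c k (s k) := by
    intro k n hn
    induction n, hn using Nat.le_induction with
    | base =>
      rw [hs, map_add, map_add, hcoef0 k k le_rfl, φ.apply_symm_apply, taylorCoeff_monomial,
        if_pos rfl, zero_add]
    | succ n hn ih =>
      rw [hs, map_add, map_add, ih, φ.apply_symm_apply, taylorCoeff_monomial,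
        if_neg (by omega), add_zero]
  -- The `k`-th coefficient of the partial sums is eventually constant, and it is continuous as a
  -- map into `S`, so the limit keeps it.
  have hlim : ∀ k, taylorCoeff a k (φ l) = c k (s k) := by
    intro k
    have h1 := ((continuous_symm_const_taylorCoeff hS hΩ a φ k).tendsto l).comp hl
    have h2 : Tendsto (fun n => φ.symm (const Ω (3 * taylorCoeff a k (φ (s n))))) atTop
        (𝓝 (φ.symm (const Ω (3 * c k (s k))))) := by
      refine tendsto_const_nhds.congr' ?_
      filter_upwards [eventually_gt_atTop k] with n hn
      rw [hcoef k n hn]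
    have h3 := φ.symm.injective (tendsto_nhds_unique h1 h2)
    have h4 : 3 * taylorCoeff a k (φ l) = 3 * c k (s k) :=
      congrArg (fun f : AnalyticFun Ω => f a) h3
    exact mul_left_cancel₀ (by norm_num) h4
  obtain ⟨C, M, hCM⟩ := exists_norm_taylorCoeff_le a (φ l)
  have ht := (FloorSemiring.tendsto_pow_div_factorial_atTop M).const_mul C
  rw [mul_zero] at ht
  obtain ⟨n, hn⟩ := (ht.eventually (gt_mem_nhds zero_lt_one)).exists
  have h1 : (n.factorial : ℝ) ≤ C * M ^ n := by
    have := hCM n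
    rw [hlim] at this
    exact (hc n _).trans this
  rw [mul_div_assoc', div_lt_one (by positivity)] at hn
  linarith

open Filter Topology in
/-- The constants carry their usual topology in `S`. -/
theorem continuous_symm_const (hS : IsPolishLieRing S)
    (hΩ : IsPreconnected (Ω : Set ℂ)) (a : Ω) (φ : S ≃ₗ⁅ℤ⁆ AnalyticFun Ω) : Continuous fun c : ℂ => φ.symm (const Ω c) := by
  have := hS.polish
  have := hS.topologicalAddGroup
  -- The constants inside `S` are the centralizer of `e`, hence closed and Polish.
  let e : S := φ.symm (const Ω 1)
  let K : AddSubgroup S := (AddMonoidHom.mk' (fun x : S => ⁅e, x⁆) (lie_add e)).ker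
  have hK : IsClosed (K : Set S) := isClosed_eq
    (hS.continuous_bracket.comp (continuous_const.prodMk continuous_id)) continuous_const
  have : PolishSpace K := hK.polishSpace
  have hconst : ∀ x : K, φ x = const Ω (φ x a) := fun x => by
    apply eq_const_of_lie_eq_zero hΩ
    have h1 : ⁅e, (x : S)⁆ = 0 := x.2
    have h2 := congrArg φ h1
    rwa [LieEquiv.map_lie, map_zero, φ.apply_symm_apply] at h2
  have hmem : ∀ c : ℂ, φ.symm (const Ω c) ∈ K := fun c => by
    change ⁅φ.symm (const Ω 1), φ.symm (const Ω c)⁆ = 0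
    rw [← LieEquiv.map_lie, const_one_lie_const, map_zero]
  let v : K →+ ℂ := AddMonoidHom.mk' (fun x => φ x a) fun x y => by
    rw [AddSubgroup.coe_add, map_add, add_apply]
  have hv : ∀ c, v ⟨φ.symm (const Ω c), hmem c⟩ = c := fun c => by
    change φ (φ.symm (const Ω c)) a = c
    rw [φ.apply_symm_apply, const_apply]
  have hvinv : ∀ x : K, φ.symm (const Ω (v x)) = x := fun x => by
    rw [φ.symm_apply_eq]; exact (hconst x).symm
  have hbij : Function.Bijective v :=
    ⟨fun x y h => Subtype.ext (by rw [← hvinv x, ← hvinv y, h]), fun c => ⟨_, hv c⟩⟩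
  have hcont : Continuous v := by
    apply continuous_of_continuousAt_zero
    rw [ContinuousAt, map_zero, Metric.tendsto_nhds]
    by_contra! hcon
    obtain ⟨ε, hε, hfreq⟩ := hcon
    apply not_forall_exists_large_const hS hΩ a φ
    intro U hU R
    -- Elements near zero with value at least `ε` in modulus become, multiplied by `N`, constants of
    -- modulus at least `R` that are still in `U`.
    obtain ⟨N, hN⟩ := exists_nat_ge (R / ε)
    have hU' : (fun x : K => ((N • x : K) : S)) ⁻¹' U ∈ 𝓝 (0 : K) := by
      have hc : Continuous fun x : K => ((N • x : K) : S) :=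
        continuous_subtype_val.comp (continuous_const_smul N)
      exact hc.continuousAt.preimage_mem_nhds (by simpa using hU)
    obtain ⟨x, hx, hxU⟩ := (hfreq.and_eventually hU').exists
    refine ⟨v (N • x), by rw [hvinv]; exact hxU, ?_⟩
    rw [dist_zero_right] at hx
    rw [map_nsmul, nsmul_eq_mul, norm_mul, Complex.norm_natCast]
    calc R ≤ N * ε := (div_le_iff₀ hε).1 hN
      _ ≤ N * ‖v x‖ := by gcongr
  let h := (Equiv.ofBijective v hbij).toHomeomorphOfContinuousOpen hcont
    (v.isOpenMap_of_polish hcont hbij)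
  refine (continuous_subtype_val.comp h.symm.continuous).congr fun c => ?_
  have h1 : h.symm c = ⟨φ.symm (const Ω c), hmem c⟩ := h.symm_apply_eq.2 (hv c).symm
  rw [Function.comp_apply, h1]

end Transport

/-! ### Continuity of the isomorphism, and the punctured plane. -/

/-- The transport result applied to `𝒜(Ω)` itself with the identity isomorphism. -/
theorem continuous_taylorCoeff (hΩ : IsPreconnected (Ω : Set ℂ)) (a : Ω) (n : ℕ) :
    Continuous fun f : AnalyticFun Ω => taylorCoeff a n f :=
  (continuous_eval a).comp ((continuous_transport_divCoord isPolishLieRing hΩ a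
    (LieEquiv.refl : AnalyticFun Ω ≃ₗ⁅ℤ⁆ AnalyticFun Ω)).iterate n)

/-- For a nonempty connected open set `Ω`, the Lie ring `𝒜(Ω)` is algebraically determined. -/
theorem isAlgebraicallyDetermined (hΩ : IsConnected (Ω : Set ℂ)) :
    IsAlgebraicallyDetermined.{0, v} (AnalyticFun Ω) := by
  refine ⟨isPolishLieRing, fun S _ _ hS φ => ?_⟩
  have := hS.polish
  have := hS.topologicalAddGroup
  obtain ⟨a, ha⟩ := hΩ.nonempty
  let a : Ω := ⟨a, ha⟩
  let ψ : S →+ AnalyticFun Ω := AddMonoidHom.mk' φ (map_add φ)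
  have hψ : Continuous ψ := by
    apply AddMonoidHom.continuous_of_isClosed_graph
    -- Coefficients are compared inside `S`: the left side is continuous there directly, the right
    -- side because constants embed continuously into `S`.
    have : {p : S × AnalyticFun Ω | ψ p.1 = p.2} = ⋂ n : ℕ, {p : S × AnalyticFun Ω |
        φ.symm (const Ω (3 * taylorCoeff a n (φ p.1))) =
          φ.symm (const Ω (3 * taylorCoeff a n p.2))} := by
      ext ⟨x, f⟩
      simp only [Set.mem_iInter, Set.mem_ofPred_eq]
      constructor
      · rintro (rfl : φ x = f) n
        rfl
      · intro h
        refine sub_eq_zero.1 (eq_zero_of_taylorCoeff_eq_zero hΩ.isPreconnected a fun n => ?_)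
        have h1 : 3 * taylorCoeff a n (φ x) = 3 * taylorCoeff a n f :=
          congrArg (fun g : AnalyticFun Ω => g a) (φ.symm.injective (h n))
        rw [map_sub, sub_eq_zero]
        exact mul_left_cancel₀ (by norm_num) h1
    rw [this]
    refine isClosed_iInter fun n => isClosed_eq
      ((continuous_symm_const_taylorCoeff hS hΩ.isPreconnected a φ n).comp continuous_fst)
      ((continuous_symm_const hS hΩ.isPreconnected a φ).comp (continuous_const.mul
        ((continuous_taylorCoeff hΩ.isPreconnected a n).comp continuous_snd)))
  exact ⟨hψ, ψ.isOpenMap_of_polish hψ φ.bijective, φ.bijective⟩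

end AnalyticFun

theorem isConnected_puncturedPlane {n : ℕ} (lam : Fin n → ℂ) :
    IsConnected (puncturedPlane lam : Set ℂ) :=
  (Set.finite_range lam).countable.isConnected_compl_of_one_lt_rank
    (by rw [Complex.rank_real_complex]; exact Cardinal.one_lt_two)

theorem mainTheorem9 (n : ℕ) (lam : Fin n → ℂ) :
    IsAlgebraicallyDetermined.{0, v} (AnalyticFun (puncturedPlane lam)) :=
  AnalyticFun.isAlgebraicallyDetermined (isConnected_puncturedPlane lam)
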